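/- **Predictability of the average quality ranking.** Consider a mixed multinomial logit (MMNL) trial-offer market with items $1,\dots,N$, consumer classes $1,\dots,K$ ($K\ge 1$), arrival rates $\lambda_k>0$ and class weights $w_k=\lambda_k/\sum_{l=1}^K\lambda_l$, position visibilities $v_1\ge v_2\ge\dots\ge v_N\ge 0$, appeals $a_{i,k}>0$, qualities $q_{i,k}\in[0,1]$ and a constant $z\ge 0$. Write $\bar q_i=\sum_{k=1}^K w_k q_{i,k}$ for the weighted average quality of item $i$. Let $d_i^t$ be the number of purchases of item $i$ before the arrival of consumer $t$, with $d^0=0$. Let $\sigma$ be a static ranking, i.e. a permutation of $\{1,\dots,N\}$ placing item $i$ in position $\sigma(i)$ for every consumer. In each period $t$ one consumer arrives; independently of the past, she belongs to class $k$ with probability $w_k$; given class $k$, she tries item $i$ with probability $$p_{i,k}(\sigma,d^t)=\frac{v_{\sigma(i)}(a_{i,k}+d_i^t)}{\sum_{j=1}^N v_{\sigma(j)}(a_{j,k}+d_j^t)+z}$$ (and otherwise tries nothing), and then buys the tried item with probability $q_{i,k}$. If she buys item $i$, then $d_i^{t+1}=d_i^t+1$; all other counts stay unchanged. Suppose that $\sigma$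 is the average quality ranking, i.e. it orders the items by decreasing $\bar q_i$, and that $\sigma$ is tie-breaking, i.e. there is an item $i^*$ with $\bar q_{i^*}v_{\sigma(i^*)}>\bar q_i v_{\sigma(i)}$ for all $i\neq i^*$. Suppose also that $\bar q_i v_{\sigma(i)}>0$ for at least one item $i$ (for $N\ge 2$ this follows from tie-breaking). Then this item $i^*$ has the highest weighted average quality, $\bar q_{i^*}=\max_i\bar q_i$, and the market goes predictably to a monopoly for $i^*$: with probability one, its market share $$\phi_{i^*}^t=\frac{d_{i^*}^t}{\sum_{j=1}^N d_j^t}$$ converges to $1$ as $t\to\infty$. -/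

import Mathlib

open Filter Topology MeasureTheory ProbabilityTheory

noncomputable section

/-- The data of a trial-offer market with `N` items and `K` classes of consumers whose choices
follow a mixed multinomial logit. Items and positions are both indexed by `Fin N`; position `0`
is the most visible one. -/
structure MMNL (N K : ℕ) where
  /-- there is at least one class of consumers -/
  classes_pos : 0 < K
  /-- the Poisson arrival rate of each class of consumers -/
  rate : Fin K → ℝ
  rate_pos : ∀ k, 0 < rate k
  /-- the visibility of each position -/
  visibility : Fin N → ℝ
  visibility_nonneg : ∀ j, 0 ≤ visibility j
  visibility_antitone : Antitone visibility
  /-- `appeal i k` is the intrinsic appeal of item `i` for class `k` -/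
  appeal : Fin N → Fin K → ℝ
  appeal_pos : ∀ i k, 0 < appeal i k
  /-- `quality i k` is the probability that a consumer of class `k` who tries item `i` buys it -/
  quality : Fin N → Fin K → ℝ
  quality_nonneg : ∀ i k, 0 ≤ quality i k
  quality_le_one : ∀ i k, quality i k ≤ 1
  /-- the weight of trying no item at all -/
  z : ℝ
  z_nonneg : 0 ≤ z

/-- A vector of past purchases: `d i` is the number of times item `i` has been bought. -/
abbrev Purchases (N : ℕ) : Type := Fin N → ℕ

/-- A ranking sends each item to its position. -/
abbrev Ranking (N : ℕ) : Type := Equiv.Perm (Fin N)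

/-- A ranking policy returns a ranking, given the vector of past purchases. -/
abbrev RankingPolicy (N : ℕ) : Type := Purchases N → Ranking N

/-- The static ranking policy that always displays the ranking `σ`. -/
def staticPolicy {N : ℕ} (σ : Ranking N) : RankingPolicy N := fun _ => σ

namespace MMNL

variable {N K : ℕ} (M : MMNL N K)

/-- The weight of class `k`, i.e. the probability that the next consumer belongs to it. -/
def weight (k : Fin K) : ℝ := M.rate k / ∑ l, M.rate l

/-- The weighted average quality of item `i`. -/
def avgQuality (i : Fin N) : ℝ := ∑ k, M.weight k * M.quality i k

/-- The probability that a consumer of class `k` tries item `i` when the ranking is `σ` and the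
past purchases are `d`. -/
def trialProb (σ : Ranking N) (d : Purchases N) (k : Fin K) (i : Fin N) : ℝ :=
  M.visibility (σ i) * (M.appeal i k + d i) /
    (∑ j, M.visibility (σ j) * (M.appeal j k + d j) + M.z)

lemma weight_nonneg (k : Fin K) : 0 ≤ M.weight k :=
  div_nonneg (M.rate_pos k).le (Finset.sum_nonneg fun l _ => (M.rate_pos l).le)

lemma sum_weight : ∑ k, M.weight k = 1 := by
  have : Nonempty (Fin K) := ⟨⟨0, M.classes_pos⟩⟩
  have h : 0 < ∑ l, M.rate l := Finset.sum_pos (fun l _ => M.rate_pos l) Finset.univ_nonempty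
  simp only [weight, ← Finset.sum_div]
  exact div_self h.ne'

lemma trialNum_nonneg (σ : Ranking N) (d : Purchases N) (k : Fin K) (i : Fin N) :
    0 ≤ M.visibility (σ i) * (M.appeal i k + d i) :=
  mul_nonneg (M.visibility_nonneg _) (add_nonneg (M.appeal_pos i k).le (Nat.cast_nonneg _))

lemma trialProb_nonneg (σ : Ranking N) (d : Purchases N) (k : Fin K) (i : Fin N) :
    0 ≤ M.trialProb σ d k i :=
  div_nonneg (M.trialNum_nonneg σ d k i)
    (add_nonneg (Finset.sum_nonneg fun j _ => M.trialNum_nonneg σ d k j) M.z_nonneg)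

lemma sum_trialProb_le_one (σ : Ranking N) (d : Purchases N) (k : Fin K) :
    ∑ i, M.trialProb σ d k i ≤ 1 := by
  simp only [trialProb, ← Finset.sum_div]
  exact div_le_one_of_le₀ (le_add_of_nonneg_right M.z_nonneg)
    (add_nonneg (Finset.sum_nonneg fun j _ => M.trialNum_nonneg σ d k j) M.z_nonneg)

/-- The law of the class of the next consumer. -/
def classLaw : PMF (Fin K) :=
  PMF.ofFintype (fun k => ENNReal.ofReal (M.weight k)) (by
    rw [← ENNReal.ofReal_sum_of_nonneg fun k _ => M.weight_nonneg k, M.sum_weight,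
      ENNReal.ofReal_one])

/-- The law of the item tried by a consumer of class `k`; `none` means that no item is tried. -/
def trialLaw (σ : Ranking N) (d : Purchases N) (k : Fin K) : PMF (Option (Fin N)) :=
  PMF.ofFintype
    (fun o => o.elim (ENNReal.ofReal (1 - ∑ i, M.trialProb σ d k i))
      (fun i => ENNReal.ofReal (M.trialProb σ d k i))) (by
    rw [Fintype.sum_option]
    simp only [Option.elim]
    rw [← ENNReal.ofReal_sum_of_nonneg fun i _ => M.trialProb_nonneg σ d k i,
      ← ENNReal.ofReal_add (sub_nonneg.2 (M.sum_trialProb_le_one σ d k))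
        (Finset.sum_nonneg fun i _ => M.trialProb_nonneg σ d k i),
      sub_add_cancel, ENNReal.ofReal_one])

/-- The law of the decision to buy (`true`) item `i` by a consumer of class `k` who tries it. -/
def buyLaw (i : Fin N) (k : Fin K) : PMF Bool :=
  PMF.ofFintype
    (fun b => bif b then ENNReal.ofReal (M.quality i k) else ENNReal.ofReal (1 - M.quality i k)) (by
    rw [Fintype.sum_bool]
    simp only [cond_true, cond_false]
    rw [← ENNReal.ofReal_add (M.quality_nonneg i k) (sub_nonneg.2 (M.quality_le_one i k)),
      add_sub_cancel, ENNReal.ofReal_one])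

/-- One time period: a consumer arrives, possibly tries an item, and possibly buys it. This is the
law of the next vector of purchases when the current one is `d` and the ranking is `σ`. -/
def stepLaw (σ : Ranking N) (d : Purchases N) : PMF (Purchases N) :=
  M.classLaw.bind fun k =>
    (M.trialLaw σ d k).bind fun o =>
      o.elim (PMF.pure d) fun i =>
        (M.buyLaw i k).bind fun b =>
          PMF.pure (bif b then Function.update d i (d i + 1) else d)

/-- The transition kernel of the vector of purchases under the ranking policy `f`. -/
def stepKernel (f : RankingPolicy N) : Kernel (Purchases N) (Purchases N) :=
  Kernel.ofFunOfCountable fun d => (M.stepLaw (f d) d).toMeasure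

instance (f : RankingPolicy N) : IsMarkovKernel (M.stepKernel f) :=
  ⟨fun d => inferInstanceAs (IsProbabilityMeasure (M.stepLaw (f d) d).toMeasure)⟩

/-- The same kernel, as a kernel from the past up to time `t` (it reads the state at time `t`). -/
def pastKernel (f : RankingPolicy N) (t : ℕ) :
    Kernel ((s : Finset.Iic t) → Purchases N) (Purchases N) :=
  (M.stepKernel f).comap (fun x => x ⟨t, Finset.mem_Iic.2 le_rfl⟩) (measurable_pi_apply _)

instance (f : RankingPolicy N) (t : ℕ) : IsMarkovKernel (M.pastKernel f t) :=
  inferInstanceAs (IsMarkovKernel ((M.stepKernel f).comap _ _))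

/-- The law of the whole random sequence `(dᵗ)` of vectors of purchases under the ranking policy
`f`, starting with no purchases. -/
def purchaseLaw (f : RankingPolicy N) : Measure (ℕ → Purchases N) :=
  Kernel.trajMeasure (X := fun _ => Purchases N) (Measure.dirac (0 : Purchases N))
    (fun t => M.pastKernel f t)

/-- Under the ranking policy `f`, the market goes predictably to a monopoly for item `i`: with
probability one, the market share of `i` converges to `1`. -/
def GoesToMonopolyFor (f : RankingPolicy N) (i : Fin N) : Prop :=
  ∀ᵐ d ∂(M.purchaseLaw f),
    Tendsto (fun t : ℕ => (d t i : ℝ) / ∑ j, (d t j : ℝ)) atTop (𝓝 1)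

/-- `σ` orders the items by decreasing weighted average quality (ties in any order). -/
def IsAverageQualityRanking (σ : Ranking N) : Prop :=
  ∀ i j, σ i < σ j → M.avgQuality j ≤ M.avgQuality i

/-- Item `i` is the unique item with the highest product of visibility and weighted average
quality under the ranking `σ`. -/
def IsStrictBest (σ : Ranking N) (i : Fin N) : Prop :=
  ∀ j, j ≠ i → M.avgQuality j * M.visibility (σ j) < M.avgQuality i * M.visibility (σ i)

/-- The static ranking `σ` is tie-breaking. -/
def IsTieBreaking (σ : Ranking N) : Prop := ∃ i, M.IsStrictBest σ i

end MMNL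

end

/-! Put b_i = `avgQuality i * visibility (σ i)`. Past purchases enter the choices of all classes
alike; appeals and `z` are bounded corrections. Averaging over classes, item i is therefore bought
with probability close to b_i d_i / load, where load = ∑ v_{σ(j)} d_j. This is an urn with unequal
reinforcement: heuristically d_j grows like d_i to the power b_j / b_i, which is less than 1 when i
is the strict best.

Two facts make this rigorous. The count d_i tends to infinity (`tendsto_purchases_atTop`), by the
conditional Borel–Cantelli lemma. For b_j / b_i < θ < 1, the quantity (const + d_j) d_i^(-θ) is a
nonnegative supermartingale once d_i is large (`exists_buyProb_le`, `lyapunov_drift`), hence almost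
surely bounded (`ae_bddAbove_lyapunov`). So d_j / d_i = O(d_i^(θ-1)) tends to 0 for each j ≠ i, and
the share of i tends to 1. -/

namespace MMNL

/-! ### The law of one period -/

/-- The probability that the next consumer buys item `i`. -/
noncomputable def buyProb {N K : ℕ} (M : MMNL N K) (σ : Ranking N) (d : Purchases N) (i : Fin N) :
    ℝ :=
  ∑ k, M.weight k * (M.trialProb σ d k i * M.quality i k)

lemma toMeasure_bind_eq_sum {α β : Type*} [Fintype α] [MeasurableSpace β] (p : PMF α)
    (f : α → PMF β) : (p.bind f).toMeasure = ∑ a, p a • (f a).toMeasure := by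
  ext s hs
  rw [PMF.toMeasure_bind_apply _ _ _ hs, tsum_fintype, Measure.finsetSum_apply]
  rfl

variable {N K : ℕ} (M : MMNL N K) (σ : Ranking N)

lemma toMeasure_stepLaw (d : Purchases N) :
    (M.stepLaw σ d).toMeasure = ∑ k, ENNReal.ofReal (M.weight k) •
      (ENNReal.ofReal (1 - ∑ i, M.trialProb σ d k i) • Measure.dirac d +
        ∑ i, ENNReal.ofReal (M.trialProb σ d k i) •
          (ENNReal.ofReal (M.quality i k) • Measure.dirac (Function.update d i (d i + 1)) +
            ENNReal.ofReal (1 - M.quality i k) • Measure.dirac d)) := by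
  simp [stepLaw, toMeasure_bind_eq_sum, classLaw, trialLaw, buyLaw, Fintype.sum_option,
    PMF.toMeasure_pure]

/-- The law is a finite mixture of Dirac masses, so `F` needs no integrability; every outcome
without a purchase contributes `F d`. -/
lemma integral_stepLaw (d : Purchases N) (F : Purchases N → ℝ) :
    ∫ y, F y ∂(M.stepLaw σ d).toMeasure =
      F d + ∑ i, M.buyProb σ d i * (F (Function.update d i (d i + 1)) - F d) := by
  have hdirac (x : Purchases N) (r : ℝ) : Integrable F (ENNReal.ofReal r • Measure.dirac x) :=
    (integrable_dirac (by simp)).smul_measure ENNReal.ofReal_ne_top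
  have hbuy (k : Fin K) (i : Fin N) : Integrable F (ENNReal.ofReal (M.trialProb σ d k i) •
          (ENNReal.ofReal (M.quality i k) • Measure.dirac (Function.update d i (d i + 1)) +
            ENNReal.ofReal (1 - M.quality i k) • Measure.dirac d)) :=
    ((hdirac _ _).add_measure (hdirac _ _)).smul_measure ENNReal.ofReal_ne_top
  have htrial (k : Fin K) : Integrable F (∑ i, ENNReal.ofReal (M.trialProb σ d k i) •
          (ENNReal.ofReal (M.quality i k) • Measure.dirac (Function.update d i (d i + 1)) +
            ENNReal.ofReal (1 - M.quality i k) • Measure.dirac d)) :=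
    integrable_finsetSum_measure.2 fun i _ => hbuy k i
  rw [toMeasure_stepLaw, integral_finsetSum_measure fun k _ =>
    ((hdirac _ _).add_measure (htrial k)).smul_measure ENNReal.ofReal_ne_top]
  have hk (k : Fin K) : ∫ y, F y ∂(ENNReal.ofReal (M.weight k) •
      (ENNReal.ofReal (1 - ∑ i, M.trialProb σ d k i) • Measure.dirac d +
        ∑ i, ENNReal.ofReal (M.trialProb σ d k i) •
          (ENNReal.ofReal (M.quality i k) • Measure.dirac (Function.update d i (d i + 1)) +
            ENNReal.ofReal (1 - M.quality i k) • Measure.dirac d))) =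
      M.weight k * F d + ∑ i, M.weight k * (M.trialProb σ d k i * M.quality i k) *
        (F (Function.update d i (d i + 1)) - F d) := by
    rw [integral_smul_measure, integral_add_measure (hdirac _ _) (htrial k),
      integral_smul_measure, integral_dirac, integral_finsetSum_measure fun i _ => hbuy k i]
    simp_rw [integral_smul_measure, integral_add_measure (hdirac _ _) (hdirac _ _), integral_smul_measure,
      integral_dirac,
      ENNReal.toReal_ofReal (M.weight_nonneg k),
      ENNReal.toReal_ofReal (sub_nonneg.2 (M.sum_trialProb_le_one σ d k)),
      ENNReal.toReal_ofReal (M.trialProb_nonneg σ d k _),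
      ENNReal.toReal_ofReal (M.quality_nonneg _ k),
      ENNReal.toReal_ofReal (sub_nonneg.2 (M.quality_le_one _ k)), smul_eq_mul]
    rw [sub_mul, Finset.sum_mul, one_mul, sub_add, ← Finset.sum_sub_distrib, mul_sub,
      Finset.mul_sum, sub_eq_add_neg, ← Finset.sum_neg_distrib]
    congr 1
    exact Finset.sum_congr rfl fun i _ => by ring
  simp_rw [hk]
  rw [Finset.sum_add_distrib, ← Finset.sum_mul, M.sum_weight, one_mul, Finset.sum_comm]
  simp_rw [buyProb, Finset.sum_mul]

lemma ae_stepLaw (d : Purchases N) : ∀ᵐ y ∂(M.stepLaw σ d).toMeasure,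
    ∀ i, d i ≤ y i ∧ y i ≤ d i + 1 := by
  have hdirac (x : Purchases N) (r : ℝ) (hx : ∀ i, d i ≤ x i ∧ x i ≤ d i + 1) :
      ∀ᵐ y ∂(ENNReal.ofReal r • Measure.dirac x), ∀ i, d i ≤ y i ∧ y i ≤ d i + 1 :=
    Measure.ae_smul_measure (by simpa [ae_dirac_eq] using hx) _
  have hd : ∀ i, d i ≤ d i ∧ d i ≤ d i + 1 := fun i => by simp
  have hu (j : Fin N) : ∀ i, d i ≤ Function.update d j (d j + 1) i ∧
      Function.update d j (d j + 1) i ≤ d i + 1 := fun i => by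
    by_cases h : i = j
    · subst h; simp
    · simp [h]
  rw [toMeasure_stepLaw, ← Measure.sum_fintype, Measure.ae_sum_iff]
  intro k
  refine Measure.ae_smul_measure (ae_add_measure_iff.2 ⟨hdirac _ _ hd, ?_⟩) _
  rw [← Measure.sum_fintype, Measure.ae_sum_iff]
  exact fun i => Measure.ae_smul_measure (ae_add_measure_iff.2
    ⟨hdirac _ _ (hu i), hdirac _ _ hd⟩) _

/-! ### Almost sure path properties and the Markov property -/

variable (f : RankingPolicy N)

instance : IsProbabilityMeasure (M.purchaseLaw f) :=
  inferInstanceAs (IsProbabilityMeasure (Kernel.trajMeasure _ _))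

lemma ae_purchaseLaw_zero : ∀ᵐ d ∂(M.purchaseLaw f), d 0 = 0 := by
  have h : (M.purchaseLaw f).map (Preorder.frestrictLe 0) =
      (Measure.dirac (0 : Purchases N)).map
        (MeasurableEquiv.piUnique fun _ : Finset.Iic 0 => Purchases N).symm := by
    rw [purchaseLaw, Kernel.trajMeasure, Measure.map_comp _ _ (by fun_prop),
      Kernel.traj_map_frestrictLe, Kernel.partialTraj_self, Measure.id_comp]
  have h2 : ∀ᵐ x ∂((M.purchaseLaw f).map (Preorder.frestrictLe 0)),
      x ⟨0, Finset.mem_Iic.2 le_rfl⟩ = 0 := by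
    rw [h, ae_map_iff (MeasurableEquiv.measurable _).aemeasurable
      (measurableSet_eq_fun (measurable_pi_apply _) measurable_const)]
    exact (ae_dirac_iff (.of_discrete)).2 rfl
  exact ae_of_ae_map (by fun_prop) h2

lemma measurable_eval_last (t : ℕ) :
    Measurable fun x : (s : Finset.Iic t) → Purchases N => x ⟨t, Finset.mem_Iic.2 le_rfl⟩ :=
  measurable_pi_apply _

lemma ae_purchaseLaw_succ : ∀ᵐ d ∂(M.purchaseLaw f), ∀ t i,
    d t i ≤ d (t + 1) i ∧ d (t + 1) i ≤ d t i + 1 := by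
  rw [ae_all_iff]
  intro t
  have h : ∀ᵐ p ∂((M.purchaseLaw f).map fun x => (Preorder.frestrictLe t x, x (t + 1))),
      ∀ i, p.1 ⟨t, Finset.mem_Iic.2 le_rfl⟩ i ≤ p.2 i ∧
        p.2 i ≤ p.1 ⟨t, Finset.mem_Iic.2 le_rfl⟩ i + 1 := by
    rw [purchaseLaw, ← Kernel.map_frestrictLe_trajMeasure_compProd_eq_map_trajMeasure]
    refine Measure.ae_compProd_of_ae_ae ?_ (ae_of_all _ fun x => ?_)
    · have hm : MeasurableSet {q : Purchases N × Purchases N |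
          ∀ i, q.1 i ≤ q.2 i ∧ q.2 i ≤ q.1 i + 1} := MeasurableSet.of_discrete
      exact ((measurable_eval_last t).comp measurable_fst).prodMk measurable_snd hm
    · exact M.ae_stepLaw _ _
  exact ae_of_ae_map (by fun_prop) h

lemma ae_purchaseLaw_monotone : ∀ᵐ d ∂(M.purchaseLaw f), ∀ i, Monotone fun t => d t i := by
  filter_upwards [M.ae_purchaseLaw_succ f] with d hd i
  exact monotone_nat_of_le_succ fun t => (hd t i).1

lemma ae_purchaseLaw_le : ∀ᵐ d ∂(M.purchaseLaw f), ∀ t i, d t i ≤ t := by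
  filter_upwards [M.ae_purchaseLaw_succ f, M.ae_purchaseLaw_zero f] with d hd h0 t i
  induction t with
  | zero => simp [h0]
  | succ t ih => exact (hd t i).2.trans (by omega)

/-- The history of the purchases. -/
noncomputable abbrev history (N : ℕ) :
    Filtration ℕ (MeasurableSpace.pi (X := fun _ : ℕ => Purchases N)) :=
  Filtration.piLE (X := fun _ : ℕ => Purchases N)

lemma measurable_history {s t : ℕ} (h : s ≤ t) :
    Measurable[history N t] fun d : ℕ → Purchases N => d s := by
  have h1 : Measurable[history N s] fun d : ℕ → Purchases N => d s := by
    rw [history, Filtration.piLE_eq_comap_frestrictLe]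
    exact (measurable_eval_last s).comp (comap_measurable _)
  exact h1.mono ((history N).mono h) le_rfl

/-- The conditional law of the next state given the history is the transition kernel. Letting `F`
see both states covers the indicator of a jump as well as functions of the next state alone. -/
lemma condExp_purchaseLaw (t : ℕ) (F : Purchases N → Purchases N → ℝ)
    (hF : Integrable (fun d => F (d t) (d (t + 1))) (M.purchaseLaw (staticPolicy σ))) :
    (M.purchaseLaw (staticPolicy σ))[fun d => F (d t) (d (t + 1)) | history N t]
      =ᵐ[M.purchaseLaw (staticPolicy σ)] fun d => F (d t) (d t) + ∑ i, M.buyProb σ (d t) i *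
        (F (d t) (Function.update (d t) i (d t i + 1)) - F (d t) (d t)) := by
  rw [history, Filtration.piLE_eq_comap_frestrictLe]
  have hF' : StronglyMeasurable fun p : ((s : Finset.Iic t) → Purchases N) × Purchases N =>
      F (p.1 ⟨t, Finset.mem_Iic.2 le_rfl⟩) p.2 := by
    have hm : Measurable fun q : Purchases N × Purchases N => F q.1 q.2 := .of_discrete
    exact (hm.comp
      (((measurable_eval_last t).comp measurable_fst).prodMk measurable_snd)).stronglyMeasurable
  have h := condExp_prod_ae_eq_integral_condDistrib
    (X := Preorder.frestrictLe (π := fun _ : ℕ => Purchases N) t)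
    (Y := fun d : ℕ → Purchases N => d (t + 1))
    (by fun_prop) (measurable_pi_apply _).aemeasurable hF' hF
  refine h.trans ?_
  have h2 := ae_of_ae_map (Preorder.measurable_frestrictLe t).aemeasurable
    (Kernel.condDistrib_trajMeasure (X := fun _ => Purchases N)
    (μ₀ := Measure.dirac (0 : Purchases N)) (κ := fun t => M.pastKernel (staticPolicy σ) t) (a := t))
  filter_upwards [h2] with d hd
  exact (congrArg (fun m : Measure (Purchases N) => ∫ y, F (d t) y ∂m) hd).trans
    (M.integral_stepLaw σ (d t) (F (d t)))

/-! ### Purchase probabilities bounded uniformly over classes -/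

/-- The total number of past purchases, weighted by visibility. -/
noncomputable def load (d : Purchases N) : ℝ := ∑ j, M.visibility (σ j) * d j

/-- A bound, uniform in the class, for the part of the total attraction that does not depend on
the past purchases. -/
noncomputable def offset : ℝ := ∑ k, (∑ j, M.visibility (σ j) * M.appeal j k + M.z)

lemma load_nonneg (d : Purchases N) : 0 ≤ M.load σ d :=
  Finset.sum_nonneg fun _ _ => mul_nonneg (M.visibility_nonneg _) (Nat.cast_nonneg _)

lemma le_load (d : Purchases N) (i : Fin N) : M.visibility (σ i) * d i ≤ M.load σ d :=
  Finset.single_le_sum (f := fun j => M.visibility (σ j) * (d j : ℝ))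
    (fun _ _ => mul_nonneg (M.visibility_nonneg _) (Nat.cast_nonneg _)) (Finset.mem_univ i)

lemma offset_term_nonneg (k : Fin K) :
    0 ≤ ∑ j, M.visibility (σ j) * M.appeal j k + M.z :=
  add_nonneg (Finset.sum_nonneg fun _ _ => mul_nonneg (M.visibility_nonneg _)
    (M.appeal_pos _ _).le) M.z_nonneg

lemma offset_nonneg : 0 ≤ M.offset σ :=
  Finset.sum_nonneg fun k _ => M.offset_term_nonneg σ k

lemma offset_term_le (k : Fin K) :
    ∑ j, M.visibility (σ j) * M.appeal j k + M.z ≤ M.offset σ :=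
  Finset.single_le_sum (f := fun k => ∑ j, M.visibility (σ j) * M.appeal j k + M.z)
    (fun k _ => M.offset_term_nonneg σ k) (Finset.mem_univ k)

lemma trialProb_eq (d : Purchases N) (k : Fin K) (i : Fin N) :
    M.trialProb σ d k i = M.visibility (σ i) * (M.appeal i k + d i) /
      ((∑ j, M.visibility (σ j) * M.appeal j k + M.z) + M.load σ d) := by
  simp only [trialProb, load, mul_add, Finset.sum_add_distrib]
  congr 1
  ring

lemma buyProb_nonneg (d : Purchases N) (i : Fin N) : 0 ≤ M.buyProb σ d i :=
  Finset.sum_nonneg fun k _ => mul_nonneg (M.weight_nonneg k)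
    (mul_nonneg (M.trialProb_nonneg σ d k i) (M.quality_nonneg i k))

lemma avgQuality_nonneg (i : Fin N) : 0 ≤ M.avgQuality i :=
  Finset.sum_nonneg fun k _ => mul_nonneg (M.weight_nonneg k) (M.quality_nonneg i k)

/-- Enlarging each class's denominator to the common value `offset + load` lets the average over
classes factor out as `avgQuality`. Positive visibility keeps the original denominators nonzero. -/
lemma le_buyProb {i : Fin N} (hv : 0 < M.visibility (σ i)) (d : Purchases N) :
    (M.visibility (σ i) * ∑ k, M.weight k * (M.quality i k * M.appeal i k) +
      M.avgQuality i * M.visibility (σ i) * d i) / (M.offset σ + M.load σ d) ≤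
      M.buyProb σ d i := by
  have h : (M.visibility (σ i) * ∑ k, M.weight k * (M.quality i k * M.appeal i k) +
      M.avgQuality i * M.visibility (σ i) * d i) / (M.offset σ + M.load σ d) =
      ∑ k, M.weight k * (M.visibility (σ i) * (M.appeal i k + d i) /
        (M.offset σ + M.load σ d) * M.quality i k) := by
    rw [avgQuality, Finset.mul_sum, Finset.sum_mul, Finset.sum_mul, ← Finset.sum_add_distrib,
      Finset.sum_div]
    exact Finset.sum_congr rfl fun k _ => by ring
  rw [h]
  refine Finset.sum_le_sum fun k _ => mul_le_mul_of_nonneg_left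
    (mul_le_mul_of_nonneg_right ?_ (M.quality_nonneg i k)) (M.weight_nonneg k)
  rw [trialProb_eq]
  refine div_le_div_of_nonneg_left (M.trialNum_nonneg σ d k i) ?_
    (by gcongr; exact M.offset_term_le σ k)
  refine add_pos_of_pos_of_nonneg (add_pos_of_pos_of_nonneg ?_ M.z_nonneg) (M.load_nonneg σ d)
  exact Finset.sum_pos' (fun j _ => mul_nonneg (M.visibility_nonneg _) (M.appeal_pos _ _).le)
    ⟨i, Finset.mem_univ i, mul_pos hv (M.appeal_pos i k)⟩

lemma buyProb_le (d : Purchases N) (hd : 0 < M.load σ d) (j : Fin N) :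
    M.buyProb σ d j ≤
      M.avgQuality j * M.visibility (σ j) * (∑ k, M.appeal j k + d j) / M.load σ d := by
  have h : M.avgQuality j * M.visibility (σ j) * (∑ k, M.appeal j k + d j) / M.load σ d =
      ∑ k, M.weight k * (M.visibility (σ j) * (∑ k, M.appeal j k + d j) / M.load σ d *
        M.quality j k) := by
    rw [avgQuality, Finset.sum_mul, Finset.sum_mul, Finset.sum_div]
    exact Finset.sum_congr rfl fun k _ => by ring
  rw [h]
  refine Finset.sum_le_sum fun k _ => mul_le_mul_of_nonneg_left
    (mul_le_mul_of_nonneg_right ?_ (M.quality_nonneg j k)) (M.weight_nonneg k)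
  rw [trialProb_eq]
  have ha : M.appeal j k ≤ ∑ k, M.appeal j k :=
    Finset.single_le_sum (f := fun k => M.appeal j k) (fun k _ => (M.appeal_pos j k).le)
      (Finset.mem_univ k)
  have hn : 0 ≤ ∑ k, M.appeal j k := (M.appeal_pos j k).le.trans ha
  have := M.visibility_nonneg (σ j)
  have := M.offset_term_nonneg σ k
  gcongr
  linarith

/-! ### Divergence of the purchases of the best item -/

/-- At most t purchases of each item precede time t, so the conditional probability of buying `i` is
at least a constant over t + 1. The harmonic series diverges, and Lévy's conditional Borel–Cantelli
lemma gives infinitely many purchases. -/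
lemma tendsto_purchases_atTop {i : Fin N} (hi : 0 < M.avgQuality i * M.visibility (σ i)) :
    ∀ᵐ d ∂(M.purchaseLaw (staticPolicy σ)), Tendsto (fun t => d t i) atTop atTop := by
  have hv : 0 < M.visibility (σ i) := pos_of_mul_pos_right hi (M.avgQuality_nonneg i)
  have hq : 0 < M.avgQuality i := pos_of_mul_pos_left hi hv.le
  set α : ℝ := M.visibility (σ i) * ∑ k, M.weight k * (M.quality i k * M.appeal i k) with hα
  have hα0 : 0 < α := by
    refine mul_pos hv ?_
    obtain ⟨k, -, hk⟩ : ∃ k ∈ Finset.univ, (0 : ℝ) < M.weight k * M.quality i k :=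
      Finset.exists_lt_of_sum_lt (by simpa [avgQuality] using hq)
    refine Finset.sum_pos' (fun k _ => mul_nonneg (M.weight_nonneg k)
      (mul_nonneg (M.quality_nonneg i k) (M.appeal_pos i k).le)) ⟨k, Finset.mem_univ k, ?_⟩
    rw [← mul_assoc]
    exact mul_pos hk (M.appeal_pos i k)
  set S : ℝ := ∑ j, M.visibility (σ j) with hS
  have hS0 : 0 < S := Finset.sum_pos' (fun _ _ => M.visibility_nonneg _) ⟨i, Finset.mem_univ i, hv⟩
  have hoff := M.offset_nonneg σ
  -- The constant comes from offset + load ≤ offset + S t ≤ (offset + S)(t + 1), with only the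
  -- appeal part `α` of the numerator kept.
  have hlow (d : Purchases N) (t : ℕ) (hd : ∀ j, d j ≤ t) :
      α / (M.offset σ + S) * (1 / ((t : ℝ) + 1)) ≤ M.buyProb σ d i := by
    have hload : M.load σ d ≤ S * t := by
      rw [hS, Finset.sum_mul]
      exact Finset.sum_le_sum fun j _ => mul_le_mul_of_nonneg_left (by exact_mod_cast hd j)
        (M.visibility_nonneg _)
    have hload0 : 0 < M.offset σ + M.load σ d := by
      have := M.load_nonneg σ d
      by_contra! hneg
      have h1 : M.offset σ = 0 := by linarith
      obtain ⟨k⟩ : Nonempty (Fin K) := ⟨⟨0, M.classes_pos⟩⟩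
      have h2 : M.visibility (σ i) * M.appeal i k ≤ M.offset σ :=
        (Finset.single_le_sum (f := fun j => M.visibility (σ j) * M.appeal j k)
          (fun j _ => mul_nonneg (M.visibility_nonneg _) (M.appeal_pos _ _).le)
          (Finset.mem_univ i)).trans
          ((le_add_of_nonneg_right M.z_nonneg).trans (M.offset_term_le σ k))
      have := mul_pos hv (M.appeal_pos i k)
      linarith
    refine le_trans ?_ (M.le_buyProb σ hv d)
    rw [div_mul_div_comm, mul_one]
    have ht : (0 : ℝ) ≤ t := Nat.cast_nonneg _
    refine div_le_div₀ ?_ ?_ hload0 ?_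
    · positivity
    · exact le_add_of_nonneg_right (by positivity)
    · nlinarith
  set μ := M.purchaseLaw (staticPolicy σ)
  -- `A (t + 1)` is a purchase of `i` in period t, known at time t + 1; truncated subtraction makes
  -- `A 0` empty.
  let A : ℕ → Set (ℕ → Purchases N) := fun n => {d | d (n - 1) i < d n i}
  have hA (n : ℕ) : MeasurableSet[history N n] (A n) :=
    ((measurable_history (Nat.sub_le n 1)).prodMk (measurable_history le_rfl))
      (MeasurableSet.of_discrete (s := {q : Purchases N × Purchases N | q.1 i < q.2 i}))
  let F : Purchases N → Purchases N → ℝ := fun x y => if x i < y i then 1 else 0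
  have hAF (t : ℕ) : (A (t + 1)).indicator (1 : (ℕ → Purchases N) → ℝ) =
      fun d => F (d t) (d (t + 1)) := by
    ext d
    simp [A, F, Set.indicator_apply]
  have hcond (t : ℕ) : μ[(A (t + 1)).indicator (1 : (ℕ → Purchases N) → ℝ) | history N t] =ᵐ[μ]
      fun d => M.buyProb σ (d t) i := by
    have hint : Integrable ((A (t + 1)).indicator (1 : (ℕ → Purchases N) → ℝ)) μ :=
      (integrable_const 1).indicator ((history N).le _ _ (hA _))
    rw [hAF] at hint ⊢
    refine (M.condExp_purchaseLaw σ t F hint).trans (ae_of_all _ fun d => ?_)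
    simp only [F, lt_irrefl, if_false, sub_zero, zero_add]
    rw [Finset.sum_eq_single i]
    · simp
    · intro j _ hj
      simp [Function.update_of_ne hj.symm]
    · simp
  filter_upwards [ae_mem_limsup_atTop_iff (ℱ := history N) μ hA, ae_all_iff.2 hcond,
    M.ae_purchaseLaw_monotone (staticPolicy σ), M.ae_purchaseLaw_le (staticPolicy σ)]
    with d hlim hc hmono hle
  have hsum : Tendsto (fun n : ℕ => ∑ k ∈ Finset.range n,
      (μ[(A (k + 1)).indicator (1 : (ℕ → Purchases N) → ℝ) | history N k]) d) atTop atTop := by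
    refine tendsto_atTop_mono (fun n => ?_)
      (Real.tendsto_sum_range_one_div_nat_succ_atTop.const_mul_atTop
        (div_pos hα0 (add_pos_of_nonneg_of_pos hoff hS0)))
    rw [Finset.mul_sum]
    refine Finset.sum_le_sum fun k _ => ?_
    rw [hc k]
    exact hlow _ _ (hle k)
  have hfreq := mem_limsup_iff_frequently_mem.1 (hlim.2 hsum)
  refine tendsto_atTop_atTop_of_monotone (hmono i) fun b => ?_
  induction b with
  | zero => exact ⟨0, Nat.zero_le _⟩
  | succ b ih =>
    obtain ⟨n, hn⟩ := ih
    obtain ⟨m, hm, hAm⟩ := (frequently_atTop.1 hfreq) (n + 1)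
    exact ⟨m, (hn.trans (hmono i (by omega : n ≤ m - 1))).trans_lt hAm⟩

/-! ### The Lyapunov supermartingale -/

/-- Bernoulli's inequality for the concave power, applied to (1 - 1/(x+1))^θ. -/
lemma rpow_neg_succ_le {x θ : ℝ} (hx : 0 < x) (h0 : 0 ≤ θ) (h1 : θ ≤ 1) :
    (x + 1) ^ (-θ) ≤ x ^ (-θ) * (1 - θ / (x + 1)) := by
  have hx1 : 0 < x + 1 := by linarith
  have h := rpow_one_add_le_one_add_mul_self (s := -(1 / (x + 1)))
    (neg_le_neg (by rw [div_le_one hx1]; linarith)) h0 h1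
  have e : 1 + -(1 / (x + 1)) = x / (x + 1) := by field_simp; ring
  rw [e, Real.div_rpow hx.le hx1.le] at h
  have e2 : 1 + θ * -(1 / (x + 1)) = 1 - θ / (x + 1) := by ring
  rw [e2] at h
  rw [Real.rpow_neg hx.le, Real.rpow_neg hx1.le]
  calc ((x + 1) ^ θ)⁻¹ = (x ^ θ)⁻¹ * (x ^ θ / (x + 1) ^ θ) := by
        have := Real.rpow_pos_of_pos hx θ
        field_simp
    _ ≤ _ := by gcongr

/-- A Lyapunov function that compares the purchases of item `j` with those of item `i`. -/
noncomputable def lyapunov (i j : Fin N) (θ : ℝ) (d : Purchases N) : ℝ :=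
  (∑ k, M.appeal j k + d j) * (d i : ℝ) ^ (-θ)

lemma sum_appeal_nonneg (j : Fin N) : 0 ≤ ∑ k, M.appeal j k :=
  Finset.sum_nonneg fun k _ => (M.appeal_pos j k).le

lemma lyapunov_nonneg (i j : Fin N) (θ : ℝ) (d : Purchases N) : 0 ≤ M.lyapunov i j θ d :=
  mul_nonneg (add_nonneg (M.sum_appeal_nonneg j) (Nat.cast_nonneg _))
    (Real.rpow_nonneg (Nat.cast_nonneg _) _)

lemma lyapunov_le {i j : Fin N} {θ : ℝ} (hθ : 0 < θ) (d : Purchases N) :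
    M.lyapunov i j θ d ≤ ∑ k, M.appeal j k + d j := by
  refine mul_le_of_le_one_right (add_nonneg (M.sum_appeal_nonneg j) (Nat.cast_nonneg _)) ?_
  rcases Nat.eq_zero_or_pos (d i) with h | h
  -- The convention `0 ^ (-θ) = 0` keeps the bound valid before the first purchase of `i`.
  · simp [h, Real.zero_rpow (neg_ne_zero.2 hθ.ne')]
  · exact Real.rpow_le_one_of_one_le_of_nonpos (by exact_mod_cast h) (by linarith)

/-- The errors from the offset and from replacing d_i by d_i + 1 are the factors (C + V)/V and (x +
1)/x. Since V ≥ v x, both tend to 1 as x = d_i grows, and the strict inequality in `hθ` absorbs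
them. -/
lemma exists_buyProb_le {i j : Fin N} (hi : 0 < M.avgQuality i * M.visibility (σ i)) {θ : ℝ}
    (hθ : M.avgQuality j * M.visibility (σ j) < M.avgQuality i * M.visibility (σ i) * θ) :
    ∃ n : ℕ, 1 ≤ n ∧ ∀ d : Purchases N, n ≤ d i →
      M.buyProb σ d j ≤ M.buyProb σ d i * ((∑ k, M.appeal j k + d j) * (θ / (d i + 1))) := by
  have hv : 0 < M.visibility (σ i) := pos_of_mul_pos_right hi (M.avgQuality_nonneg i)
  set v := M.visibility (σ i)
  set C := M.offset σ
  have hC : 0 ≤ C := M.offset_nonneg σ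
  set bi := M.avgQuality i * v
  have hbj : 0 ≤ M.avgQuality j * M.visibility (σ j) :=
    mul_nonneg (M.avgQuality_nonneg j) (M.visibility_nonneg _)
  set bj := M.avgQuality j * M.visibility (σ j)
  have hlim : Tendsto (fun n : ℕ => bj * (1 + C / v / n) * (1 + 1 / (n : ℝ))) atTop
      (𝓝 (bj * (1 + 0) * (1 + 0))) :=
    ((tendsto_const_div_atTop_nhds_zero_nat _).const_add 1 |>.const_mul bj).mul
      ((tendsto_const_div_atTop_nhds_zero_nat _).const_add 1)
  have hev : ∀ᶠ n : ℕ in atTop, bj * (1 + C / v / n) * (1 + 1 / (n : ℝ)) < bi * θ :=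
    hlim.eventually_lt_const (by simpa using hθ)
  obtain ⟨n, hn⟩ := eventually_atTop.1 hev
  refine ⟨max n 1, le_max_right _ _, fun d hd => ?_⟩
  have hx1 : 1 ≤ d i := (le_max_right _ _).trans hd
  have hx : (0 : ℝ) < d i := by exact_mod_cast hx1
  have hb := hn (d i) ((le_max_left _ _).trans hd)
  have hload : v * d i ≤ M.load σ d := M.le_load σ d i
  set x : ℝ := (d i : ℝ)
  set V := M.load σ d
  have hV : 0 < V := (mul_pos hv hx).trans_le hload
  set y : ℝ := ∑ k, M.appeal j k + d j
  have hy : 0 ≤ y := add_nonneg (M.sum_appeal_nonneg j) (Nat.cast_nonneg _)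
  have hθ0 : 0 ≤ θ := (pos_of_mul_pos_right (hbj.trans_lt hθ) hi.le).le
  have hlow : bi * x / (C + V) ≤ M.buyProb σ d i := by
    refine le_trans ?_ (M.le_buyProb σ hv d)
    have : 0 ≤ v * ∑ k, M.weight k * (M.quality i k * M.appeal i k) :=
      mul_nonneg hv.le (Finset.sum_nonneg fun k _ => mul_nonneg (M.weight_nonneg k)
        (mul_nonneg (M.quality_nonneg i k) (M.appeal_pos i k).le))
    gcongr
    exact le_add_of_nonneg_left this
  refine (M.buyProb_le σ d hV j).trans (le_trans ?_
    (mul_le_mul_of_nonneg_right hlow (by positivity)))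
  have hCV : (C + V) / V ≤ 1 + C / v / x := by
    rw [add_div, div_self hV.ne', add_comm, div_div]
    gcongr
  have key : bj * ((C + V) / V) * ((x + 1) / x) ≤ bi * θ := by
    refine le_trans ?_ hb.le
    rw [add_div x, div_self hx.ne']
    gcongr
  have e1 : bj * y / V = bj * ((C + V) / V) * ((x + 1) / x) * (y * x / ((C + V) * (x + 1))) := by
    field_simp
  have e2 : bi * x / (C + V) * (y * (θ / (x + 1))) = bi * θ * (y * x / ((C + V) * (x + 1))) := by
    field_simp
  rw [show M.avgQuality j * M.visibility (σ j) * y / V = bj * y / V from rfl, e1, e2]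
  exact mul_le_mul_of_nonneg_right key (by positivity)

/-- A purchase of `j` adds d_i^(-θ); a purchase of `i` removes at least the fraction θ/(d_i + 1) of
the current value. Hypothesis `h` says that the expected loss covers the expected gain. -/
lemma lyapunov_drift {i j : Fin N} (hij : j ≠ i) {θ : ℝ} (h0 : 0 ≤ θ) (h1 : θ ≤ 1)
    {d : Purchases N} (hd : 1 ≤ d i)
    (h : M.buyProb σ d j ≤ M.buyProb σ d i * ((∑ k, M.appeal j k + d j) * (θ / (d i + 1)))) :
    M.lyapunov i j θ d + ∑ l, M.buyProb σ d l *
      (M.lyapunov i j θ (Function.update d l (d l + 1)) - M.lyapunov i j θ d) ≤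
      M.lyapunov i j θ d := by
  have hx : (0 : ℝ) < d i := by exact_mod_cast hd
  rw [Fintype.sum_eq_add i j hij.symm]
  · have hr := rpow_neg_succ_le hx h0 h1
    have hpos := Real.rpow_pos_of_pos hx (-θ)
    have hy : 0 ≤ ∑ k, M.appeal j k + (d j : ℝ) :=
      add_nonneg (M.sum_appeal_nonneg j) (Nat.cast_nonneg _)
    have hP := M.buyProb_nonneg σ d i
    simp only [lyapunov, Function.update_self, Function.update_of_ne hij,
      Function.update_of_ne hij.symm, Nat.cast_add, Nat.cast_one]
    have a1 := mul_le_mul_of_nonneg_left hr (mul_nonneg hP hy)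
    have a2 := mul_le_mul_of_nonneg_right h hpos.le
    linear_combination a1 + a2
  · rintro l ⟨hli, hlj⟩
    simp [lyapunov, Function.update_of_ne hli.symm, Function.update_of_ne hlj.symm]

lemma ae_bddAbove_lyapunov {i j : Fin N} (hij : j ≠ i) {θ : ℝ} (h0 : 0 < θ) (h1 : θ ≤ 1) {n : ℕ}
    (hn : 1 ≤ n) (h : ∀ d : Purchases N, n ≤ d i →
      M.buyProb σ d j ≤ M.buyProb σ d i * ((∑ k, M.appeal j k + d j) * (θ / (d i + 1)))) (s : ℕ) :
    ∀ᵐ d ∂(M.purchaseLaw (staticPolicy σ)), n ≤ d s i →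
      BddAbove (Set.range fun t => M.lyapunov i j θ (d (s + t))) := by
  set μ := M.purchaseLaw (staticPolicy σ)
  let ℱ : Filtration ℕ (MeasurableSpace.pi (X := fun _ : ℕ => Purchases N)) :=
    { seq := fun t => history N (s + t)
      mono' := fun t u htu => (history N).mono (Nat.add_le_add_left htu s)
      le' := fun t => (history N).le _ }
  let A : Set (ℕ → Purchases N) := {d | n ≤ d s i}
  have hA (t : ℕ) : MeasurableSet[history N (s + t)] A :=
    (measurable_history (Nat.le_add_right s t))
      (MeasurableSet.of_discrete (s := {x : Purchases N | n ≤ x i}))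
  have hadp (t : ℕ) : StronglyMeasurable[history N t] fun d => M.lyapunov i j θ (d t) :=
    ((Measurable.of_discrete (f := M.lyapunov i j θ)).comp
      (measurable_history le_rfl)).stronglyMeasurable
  have hint (t : ℕ) : Integrable (fun d => M.lyapunov i j θ (d t)) μ := by
    refine Integrable.of_bound ((hadp t).mono ((history N).le t)).aestronglyMeasurable
      (∑ k, M.appeal j k + t) ?_
    filter_upwards [M.ae_purchaseLaw_le (staticPolicy σ)] with d hd
    rw [Real.norm_of_nonneg (M.lyapunov_nonneg i j θ _)]
    refine (M.lyapunov_le h0 _).trans ?_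
    gcongr
    exact hd t j
  -- The event `A` is decided at time s and d_i never decreases, so on `A` the drift inequality
  -- holds at all later times; off `A` the process is zero.
  let Z : ℕ → (ℕ → Purchases N) → ℝ := fun t => A.indicator fun d => M.lyapunov i j θ (d (s + t))
  have hZ0 (t : ℕ) (d) : 0 ≤ Z t d := Set.indicator_nonneg (fun _ _ => M.lyapunov_nonneg i j θ _) d
  have hZ : Supermartingale Z ℱ μ := by
    refine supermartingale_nat (fun t => (hadp (s + t)).indicator (hA t))
      (fun t => (hint (s + t)).indicator ((history N).le _ _ (hA t))) fun t => ?_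
    have hc := M.condExp_purchaseLaw σ (s + t) (fun _ y => M.lyapunov i j θ y) (hint (s + t + 1))
    filter_upwards [condExp_indicator (hint (s + t + 1)) (hA t), hc,
      M.ae_purchaseLaw_monotone (staticPolicy σ)] with d hd1 hd2 hmono
    refine hd1.le.trans ?_
    by_cases hdA : d ∈ A
    · simp only [Z, Set.indicator_of_mem hdA]
      have hge : n ≤ d (s + t) i := le_trans hdA (hmono i (Nat.le_add_right s t))
      exact hd2.le.trans (M.lyapunov_drift σ hij h0.le h1 (hn.trans hge) (h _ hge))
    · simp [Z, hdA]
  -- For a nonnegative process the L¹ norm is the mean, which a supermartingale does not increase.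
  have hbdd (t : ℕ) : eLpNorm ((-Z) t) 1 μ ≤ (∫ d, Z 0 d ∂μ).toNNReal := by
    have : ∫ d, Z t d ∂μ ≤ ∫ d, Z 0 d ∂μ := by
      simpa using hZ.setIntegral_le (Nat.zero_le t) MeasurableSet.univ
    rw [Pi.neg_apply, eLpNorm_neg, eLpNorm_one_eq_lintegral_enorm,
      ← ofReal_integral_norm_eq_lintegral_enorm (hZ.integrable t),
      show (fun d => ‖Z t d‖) = Z t from funext fun d => Real.norm_of_nonneg (hZ0 t d)]
    exact ENNReal.ofReal_le_ofReal this
  filter_upwards [hZ.neg.ae_tendsto_limitProcess hbdd] with d hd hdA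
  have hZd : (fun t => M.lyapunov i j θ (d (s + t))) = fun t => -(-Z) t d := by
    ext t
    simp [Z, Set.indicator_of_mem (show d ∈ A from hdA)]
  rw [hZd]
  exact hd.neg.bddAbove_range

/-! ### From bounded Lyapunov functions to market shares -/

lemma tendsto_ratio_zero {i j : Fin N} (hi : 0 < M.avgQuality i * M.visibility (σ i))
    (hij : j ≠ i)
    (hlt : M.avgQuality j * M.visibility (σ j) < M.avgQuality i * M.visibility (σ i)) :
    ∀ᵐ d ∂(M.purchaseLaw (staticPolicy σ)),
      Tendsto (fun t => (d t j : ℝ) / d t i) atTop (𝓝 0) := by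
  -- θ > b_j / b_i gives the drift inequality; θ < 1 makes the resulting bound B d_i^(θ-1) vanish.
  obtain ⟨θ, hθ, hθ1⟩ := exists_between ((div_lt_one hi).2 hlt)
  have hθ0 : 0 < θ := lt_of_le_of_lt (div_nonneg (mul_nonneg (M.avgQuality_nonneg j)
    (M.visibility_nonneg _)) hi.le) hθ
  obtain ⟨n, hn, h⟩ := M.exists_buyProb_le σ (j := j) hi (by rwa [div_lt_iff₀' hi] at hθ)
  filter_upwards [ae_all_iff.2 (M.ae_bddAbove_lyapunov σ hij hθ0 hθ1.le hn h),
    M.tendsto_purchases_atTop σ hi] with d hb htop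
  -- This time depends on the path, hence the boundedness for all s simultaneously.
  obtain ⟨s, hs⟩ := (htop.eventually_ge_atTop n).exists
  obtain ⟨B, hB⟩ := hb s hs
  have hlim : Tendsto (fun t => B * (d t i : ℝ) ^ (-(1 - θ))) atTop (𝓝 (B * 0)) :=
    (((tendsto_rpow_neg_atTop (sub_pos.2 hθ1)).comp
      (tendsto_natCast_atTop_atTop.comp htop))).const_mul B
  rw [mul_zero] at hlim
  refine tendsto_of_tendsto_of_tendsto_of_le_of_le' tendsto_const_nhds hlim
    (Eventually.of_forall fun t => by positivity) ?_
  filter_upwards [eventually_ge_atTop s, htop.eventually_ge_atTop 1] with t hst ht1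
  have hx : (0 : ℝ) < d t i := by exact_mod_cast ht1
  obtain ⟨u, rfl⟩ := Nat.exists_eq_add_of_le hst
  have hBu : M.lyapunov i j θ (d (s + u)) ≤ B := hB ⟨u, rfl⟩
  have hpos := Real.rpow_pos_of_pos hx (-θ)
  have h2 : (d (s + u) j : ℝ) * (d (s + u) i : ℝ) ^ (-θ) ≤ B :=
    (mul_le_mul_of_nonneg_right (le_add_of_nonneg_left (M.sum_appeal_nonneg j)) hpos.le).trans hBu
  have h3 : (d (s + u) i : ℝ) ^ (-θ) * (d (s + u) i : ℝ) ^ (-(1 - θ)) = (d (s + u) i : ℝ)⁻¹ := by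
    rw [← Real.rpow_add hx, show -θ + -(1 - θ) = -1 by ring, Real.rpow_neg_one]
  rw [div_eq_mul_inv, ← h3, ← mul_assoc]
  exact mul_le_mul_of_nonneg_right h2 (Real.rpow_nonneg hx.le _)

lemma goesToMonopolyFor_of_isStrictBest {i : Fin N}
    (hi : 0 < M.avgQuality i * M.visibility (σ i)) (hbest : M.IsStrictBest σ i) :
    M.GoesToMonopolyFor (staticPolicy σ) i := by
  have hratio : ∀ᵐ d ∂(M.purchaseLaw (staticPolicy σ)), ∀ j, j ≠ i →
      Tendsto (fun t => (d t j : ℝ) / d t i) atTop (𝓝 0) := by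
    refine ae_all_iff.2 fun j => ?_
    by_cases hj : j = i
    · exact ae_of_all _ fun d h => absurd hj h
    · filter_upwards [M.tendsto_ratio_zero σ hi hj (hbest j hj)] with d hd _ using hd
  unfold GoesToMonopolyFor
  filter_upwards [hratio, M.tendsto_purchases_atTop σ hi] with d hd htop
  have hone : Tendsto (fun t => (d t i : ℝ) / d t i) atTop (𝓝 1) := by
    refine tendsto_const_nhds.congr' ?_
    filter_upwards [htop.eventually_ge_atTop 1] with t ht
    exact (div_self (by positivity)).symm
  have hsum : Tendsto (fun t => ∑ j, (d t j : ℝ) / d t i) atTop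
      (𝓝 (∑ j, if j = i then 1 else 0)) := by
    refine tendsto_finsetSum _ fun j _ => ?_
    split_ifs with hj
    · subst hj; exact hone
    · exact hd j hj
  -- The share of `i` is the reciprocal of ∑ d_j / d_i, whose limit is 1.
  have := hsum.inv₀ (by simp)
  simpa [← Finset.sum_div] using this

/-- An item of strictly higher quality cannot be ranked below `i`; ranked above, it is at least as
visible, so its product would be at least that of `i`. -/
lemma avgQuality_le_of_isStrictBest (hσ : M.IsAverageQualityRanking σ) {i : Fin N}
    (hbest : M.IsStrictBest σ i) (j : Fin N) : M.avgQuality j ≤ M.avgQuality i := by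
  rcases lt_or_ge (σ i) (σ j) with h | h
  · exact hσ i j h
  · by_contra! hlt
    have hji : j ≠ i := by rintro rfl; exact hlt.false
    exact (hbest j hji).not_ge (mul_le_mul hlt.le (M.visibility_antitone h)
      (M.visibility_nonneg _) (M.avgQuality_nonneg j))

end MMNL

theorem mainTheorem5 {N K : ℕ} (M : MMNL N K) (σ : Ranking N)
    (hσ : M.IsAverageQualityRanking σ) (htie : M.IsTieBreaking σ)
    (hpos : ∃ i, 0 < M.avgQuality i * M.visibility (σ i)) :
    ∃ i : Fin N, (∀ j, M.avgQuality j ≤ M.avgQuality i) ∧ M.IsStrictBest σ i ∧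
      M.GoesToMonopolyFor (staticPolicy σ) i := by
  obtain ⟨i, hbest⟩ := htie
  obtain ⟨j, hj⟩ := hpos
  have hi : 0 < M.avgQuality i * M.visibility (σ i) := by
    by_cases h : j = i
    · exact h ▸ hj
    · exact hj.trans (hbest j h)
  exact ⟨i, M.avgQuality_le_of_isStrictBest σ hσ hbest, hbest,
    M.goesToMonopolyFor_of_isStrictBest σ hi hbest⟩
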